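/- Let $k$ be a field and let $A$ be a finite-dimensional $k$-algebra (for instance $k$ algebraically closed and $A$ basic). Write $\mathrm{mod}(A)$ for the category of finitely generated left $A$-modules. For a family $\mathcal X$ of modules, a filtration of $M$ by $\mathcal X$ is a finite chain of submodules $0=M_0\subseteq M_1\subseteq\dots\subseteq M_n=M$ (with $n\ge 0$) such that each $M_l/M_{l-1}$ is isomorphic to a member of $\mathcal X$; $\mathcal F(\mathcal X)$ is the class of modules having such a filtration. For a module $Q$, $\mathrm{add}(Q)$ is the class of modules isomorphic to direct summands of finite direct sums of copies of $Q$. An Ext-projective stratifying system of size $t$ in $\mathrm{mod}(A)$ consists of non-zero modules $\Theta(1),\dots,\Theta(t)$ and indecomposable modules $Q(1),\dots,Q(t)$ in $\mathrm{mod}(A)$ such that * $\mathrm{Hom}_A(\Theta(j),\Theta(i))=0$ for $j>i$; * for each $i$ there is an exact sequence $0\to U(i)\to Q(i)\to\Theta(i)\to 0$ in $\mathrm{mod}(A)$ with $U(i)\in\mathcal F(\{\Theta(j): j>i\})$; * $\mathrm{Ext}^1_A(Q,X)=0$ for all $X\in\mathcal F(\Theta)$, where $Q=\bigoplus_{i=1}^tQ(i)$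 and $\mathcal F(\Theta)=\mathcal F(\{\Theta(1),\dots,\Theta(t)\})$. Its Cartan matrix is the $t\times t$ integer matrix $C_\Theta$ with entries $[C_\Theta]_{i,j}=\dim_k\mathrm{Hom}_A(Q(i),\Theta(j))$. For $M\in\mathcal F(\Theta)$, let $[M:\Theta(j)]$ be the number of subquotients isomorphic to $\Theta(j)$ in a filtration of $M$ by $\{\Theta(1),\dots,\Theta(t)\}$. Let $(\Theta,\{Q(i)\}_{i=1}^t,\le)$ be an Ext-projective stratifying system in $\mathrm{mod}(A)$, with exact sequences $0\to U(i)\to Q(i)\to\Theta(i)\to 0$ as above, such that the matrix $C_\Theta$ is diagonal. Then the multiplicities $[M:\Theta(j)]$ do not depend on the chosen filtration, and the following statements are equivalent: * (a) $[U(i):\Theta(j)]=0$ for all $i<j$; * (b) $\mathrm{Ext}^1_A(\Theta(i),\Theta(j))=0$ for all $i,j$; * (c) $Q(i)\simeq\Theta(i)$ as $A$-modules for all $i$; * (d) $U(i)=0$ for all $i$. Moreover, if one of these conditions holds, then $\mathcal F(\Theta)=\mathrm{add}(Q)$ and $\mathrm{End}_A(Q)\simeq\prod_{i=1}^t\mathrm{End}_A(Q(i))$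 as $k$-algebras. -/

import Mathlib

open CategoryTheory CategoryTheory.Limits

open scoped ModuleCat

universe w u v

/-- A filtration of the `A`-module `M` by the family `Θ`: a finite chain of submodules
`0 = M_0 ⊆ M_1 ⊆ ⋯ ⊆ M_n = M` together with, for every step `l`, an index `label l` such that the
subquotient of that step is isomorphic to `Θ (label l)`. The zero module has the filtration of
length `0`. -/
structure ModuleFiltration {A : Type u} [Ring A] {ι : Type v} (Θ : ι → ModuleCat.{u} A)
    (M : ModuleCat.{u} A) where
  /-- the number of steps -/
  length : ℕ
  /-- the submodules in the chain -/
  sub : Fin (length + 1) → Submodule A M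
  monotone_sub : Monotone sub
  sub_zero : sub 0 = ⊥
  sub_last : sub (Fin.last length) = ⊤
  /-- which member of the family occurs in each step -/
  label : Fin length → ι
  quotient_iso : ∀ l : Fin length,
    Nonempty ((↥(sub l.succ) ⧸ (sub l.castSucc).submoduleOf (sub l.succ)) ≃ₗ[A] Θ (label l))

/-- The number of steps of the filtration in which `Θ j` occurs. -/
noncomputable def ModuleFiltration.mult {A : Type u} [Ring A] {ι : Type v}
    {Θ : ι → ModuleCat.{u} A} {M : ModuleCat.{u} A} (F : ModuleFiltration Θ M) (j : ι) : ℕ :=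
  Nat.card {l : Fin F.length // F.label l = j}

/-- The class `𝓕(Θ)` of the modules that admit a filtration by the family `Θ`. -/
def filteredBy {A : Type u} [Ring A] {ι : Type v} (Θ : ι → ModuleCat.{u} A) :
    ObjectProperty (ModuleCat.{u} A) :=
  fun M => Nonempty (ModuleFiltration Θ M)

open Classical in
/-- The multiplicity `[M : Θ j]`, read off from some filtration of `M` by `Θ` (and `0` if there is
none). That the choice of the filtration does not matter is asserted separately where this is used. -/
noncomputable def filtMult {A : Type u} [Ring A] {ι : Type v} (Θ : ι → ModuleCat.{u} A)
    (M : ModuleCat.{u} A) (j : ι) : ℕ :=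
  if h : Nonempty (ModuleFiltration Θ M) then h.some.mult j else 0

/-- The class `add(Q)` of the modules isomorphic to a direct summand of a finite direct sum of
copies of `Q`. -/
def addClosure {A : Type u} [Ring A] (Q : ModuleCat.{u} A) : ObjectProperty (ModuleCat.{u} A) :=
  fun X => ∃ (n : ℕ) (Y : ModuleCat.{u} A), Nonempty (X ⊞ Y ≅ ⨁ fun _ : Fin n => Q)

/-- An Ext-projective stratifying system of size `t` in the category of finitely generated left
`A`-modules, with the exact sequences `0 → U i → Q i → Θ i → 0` as part of the data. The index set
`{1, …, t}` with its natural order is `Fin t`. -/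
structure ExtProjectiveStratifyingSystem (A : Type u) [Ring A] (t : ℕ) where
  Θ : Fin t → ModuleCat.{u} A
  Q : Fin t → ModuleCat.{u} A
  U : Fin t → ModuleCat.{u} A
  finite_Θ : ∀ i, Module.Finite A (Θ i)
  finite_Q : ∀ i, Module.Finite A (Q i)
  finite_U : ∀ i, Module.Finite A (U i)
  nonzero_Θ : ∀ i, ¬ IsZero (Θ i)
  indecomposable_Q : ∀ i, Indecomposable (Q i)
  hom_eq_zero : ∀ i j, i < j → ∀ f : Θ j ⟶ Θ i, f = 0
  α : ∀ i, U i ⟶ Q i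
  β : ∀ i, Q i ⟶ Θ i
  comp_eq_zero : ∀ i, α i ≫ β i = 0
  exact : ∀ i, (ShortComplex.mk (α i) (β i) (comp_eq_zero i)).ShortExact
  filtered_U : ∀ i, filteredBy (fun j : {j : Fin t // i < j} => Θ j) (U i)
  ext_eq_zero : ∀ X : ModuleCat.{u} A, filteredBy Θ X → ∀ e : Abelian.Ext (⨁ Q) X 1, e = 0

/-- The `Θ`-Cartan matrix, with entries `dim_k Hom_A(Q i, Θ j)`. -/
noncomputable def ExtProjectiveStratifyingSystem.cartanMatrix (k : Type w) [Field k]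
    {A : Type u} [Ring A] [Algebra k A] {t : ℕ} (S : ExtProjectiveStratifyingSystem A t) :
    Matrix (Fin t) (Fin t) ℤ :=
  Matrix.of fun i j => (Module.finrank k (S.Q i ⟶ S.Θ j) : ℤ)

/-!
Everything rests on one dimension count. Since `Ext¹(Q i, X) = 0` for every filtered `X`, the
functor `Hom(Q i, -)` is exact along a filtration, so `dim Hom(Q i, M)` is the sum over `j` of the
number of occurrences of `Θ j` times `dim Hom(Q i, Θ j)`. For a diagonal Cartan matrix only the term
`j = i` survives, and its coefficient is positive because `Q i → Θ i` is a non-zero map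
(`finrank_hom_eq_mul`, `finrank_hom_pos`). Hence multiplicities do not depend on the filtration.

For the equivalences: the filtration of `U i` uses only `Θ j` with `i < j`, so (a) forces it to have
length zero, that is (d). Then `Q i → Θ i` is an isomorphism, giving (c), and `Θ i` inherits
Ext-projectivity from `Q i`, giving (b). From (b), `Ext¹(Θ i, U i) = 0` by induction along a
filtration of `U i`; the sequence of `Q i` splits, and `U i = 0` because `Q i` is indecomposable and
`Θ i` is non-zero. Finally (d) gives (a) since a zero module has zero multiplicities.

Under these conditions every filtration splits, so filtered modules are the finite direct sums of
the `Q i`. That `add(Q)` contains nothing else is the part of the Krull–Schmidt theorem proved in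
`IsFiniteDirectSum.of_biprod_iso`: the `Q i` have local endomorphism rings by Fitting's lemma
(`isIso_or_isIso_of_indecomposable`), so a summand `Q i` of `X ⊞ Y` can be cancelled from `X` or
from `Y` by the exchange argument `exists_biprod_iso_of_isIso`. As `Hom(Q i, Q j) = 0` for `i ≠ j`,
the endomorphism algebra is a product (`nonempty_end_biproduct_algEquiv`).
-/

open scoped ZeroObject

/-! ### Finite direct sums with local summands -/

section DirectSums

variable {C : Type u} [Category.{v} C] [Abelian C]

/-- The class of finite direct sums of members of the family `Q`, repetitions allowed. It is given
inductively by splitting off one summand at a time, which makes it invariant under isomorphisms by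
construction. -/
inductive IsFiniteDirectSum {ι : Type w} (Q : ι → C) : C → Prop
  | zero {M : C} (h : IsZero M) : IsFiniteDirectSum Q M
  | cons {M N : C} (i : ι) (e : M ≅ Q i ⊞ N) (h : IsFiniteDirectSum Q N) : IsFiniteDirectSum Q M

namespace IsFiniteDirectSum

variable {ι : Type w} {Q : ι → C}

theorem of_iso {M N : C} (h : IsFiniteDirectSum Q M) (e : N ≅ M) : IsFiniteDirectSum Q N := by
  cases h with
  | zero h => exact .zero (h.of_iso e)
  | cons i e' h => exact .cons i (e ≪≫ e') h

theorem single (i : ι) {M : C} (e : M ≅ Q i) : IsFiniteDirectSum Q M :=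
  .cons (N := 0) i (e ≪≫ isoBiprodZero (isZero_zero C)) (.zero (isZero_zero C))

theorem biprod {M N : C} (hM : IsFiniteDirectSum Q M) (hN : IsFiniteDirectSum Q N) :
    IsFiniteDirectSum Q (M ⊞ N) := by
  induction hM with
  | zero h => exact hN.of_iso (isoZeroBiprod h).symm
  | cons i e _ ih => exact .cons i (biprod.mapIso e (Iso.refl _) ≪≫ biprod.associator _ _ _) ih

theorem map {κ : Type*} {R : κ → C} (h : ∀ i, ∃ j, Nonempty (Q i ≅ R j)) {M : C}
    (hM : IsFiniteDirectSum Q M) : IsFiniteDirectSum R M := by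
  induction hM with
  | zero h => exact .zero h
  | cons i e _ ih =>
    obtain ⟨j, ⟨f⟩⟩ := h i
    exact .cons j (e ≪≫ biprod.mapIso f (Iso.refl _)) ih

end IsFiniteDirectSum

/-- Splitting the first summand off a direct sum over `Fin (n + 1)`. -/
noncomputable def biproductFinSuccIso [HasFiniteBiproducts C] {n : ℕ} (Z : Fin (n + 1) → C) :
    (⨁ Z) ≅ Z 0 ⊞ ⨁ fun a : Fin n => Z a.succ where
  hom := biprod.lift (biproduct.π Z 0) (biproduct.lift fun a => biproduct.π Z a.succ)
  inv := biprod.desc (biproduct.ι Z 0) (biproduct.desc fun a => biproduct.ι Z a.succ)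
  hom_inv_id := by
    rw [biprod.lift_desc, biproduct.lift_desc, ← Fin.sum_univ_succ
      (fun a => biproduct.π Z a ≫ biproduct.ι Z a), biproduct.total]
  inv_hom_id := by
    ext a
    · simp
    · simp [biproduct.ι_π_ne Z (Fin.succ_ne_zero a).symm]
    · simp [biproduct.ι_π_ne Z (Fin.succ_ne_zero a)]
    · rename_i b
      by_cases h : a = b
      · subst h; simp
      · simp [biproduct.ι_π_ne _ h, biproduct.ι_π_ne Z ((Fin.succ_injective n).ne h)]

theorem IsFiniteDirectSum.biproduct [HasFiniteBiproducts C] {ι : Type w} {Q : ι → C} :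
    ∀ {n : ℕ} (Z : Fin n → C), (∀ a, IsFiniteDirectSum Q (Z a)) → IsFiniteDirectSum Q (⨁ Z)
  | 0, Z, _ => .zero <| (IsZero.iff_id_eq_zero _).2 <| by ext a; exact a.elim0
  | _ + 1, Z, h => (IsFiniteDirectSum.biprod (h 0)
      (IsFiniteDirectSum.biproduct _ fun a => h a.succ)).of_iso (biproductFinSuccIso Z)

/-- A retract in an abelian category is a direct summand. -/
theorem CategoryTheory.Retract.exists_iso_biprod {X Z : C} (h : Retract X Z) :
    ∃ (Y : C) (e : Z ≅ X ⊞ Y), h.i ≫ e.hom = biprod.inl := by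
  let S := ShortComplex.mk h.i (cokernel.π h.i) (cokernel.condition _)
  have hS : S.Exact := ShortComplex.exact_cokernel h.i
  let s := ShortComplex.Splitting.ofExactOfRetraction S hS h.r h.retract
    (inferInstanceAs (Epi (cokernel.π h.i)))
  refine ⟨cokernel h.i, s.isoBinaryBiproduct, ?_⟩
  change S.f ≫ biprod.lift s.r S.g = _
  ext
  · rw [Category.assoc, biprod.lift_fst, s.f_r, biprod.inl_fst]
  · rw [Category.assoc, biprod.lift_snd, S.zero, biprod.inl_snd]

/-- Exchange: in a decomposition `X ⊞ Y ≅ Q ⊞ M`, if the component `Q ⟶ X ⟶ Q` is invertible then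
`Q` may be cancelled from `X`. -/
theorem exists_biprod_iso_of_isIso {X Y Q M : C} (e : X ⊞ Y ≅ Q ⊞ M)
    (h : IsIso ((biprod.inl ≫ e.inv ≫ biprod.fst) ≫ biprod.inl ≫ e.hom ≫ biprod.fst)) :
    ∃ X' : C, Nonempty (X ≅ Q ⊞ X') ∧ Nonempty (X' ⊞ Y ≅ M) := by
  set p := biprod.inl ≫ e.inv ≫ biprod.fst with hp
  set q := biprod.inl ≫ e.hom ≫ biprod.fst with hq
  let r : Retract Q X := { i := p, r := q ≫ inv (p ≫ q), retract := by simp [← Category.assoc] }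
  obtain ⟨X', f, hf⟩ := r.exists_iso_biprod
  have hf' : biprod.inl ≫ f.inv = p := by rw [← hf]; simp [r]
  let g : Q ⊞ (X' ⊞ Y) ≅ Q ⊞ M :=
    (biprod.associator _ _ _).symm ≪≫ biprod.mapIso f.symm (Iso.refl Y) ≪≫ e
  have hg : biprod.inl ≫ g.hom ≫ biprod.fst = p ≫ q := by
    have : biprod.inl ≫ (biprod.associator Q X' Y).inv = biprod.inl ≫ biprod.inl := by
      ext <;> simp [biprod.associator]
    simp only [g, Iso.trans_hom, Iso.symm_hom, Category.assoc, biprod.mapIso_hom]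
    rw [reassoc_of% this]
    simp [reassoc_of% hf', hq]
  have : IsIso (biprod.inl ≫ g.hom ≫ biprod.fst) := by rw [hg]; exact h
  exact ⟨X', ⟨f⟩, ⟨Biprod.isoElim g⟩⟩

/-- Krull–Schmidt for direct summands: the summands of a finite direct sum of objects with local
endomorphism rings are again such direct sums. Locality is the hypothesis that of two endomorphisms
with sum `1`, one is invertible. -/
theorem IsFiniteDirectSum.of_biprod_iso {ι : Type w} {Q : ι → C}
    (hQ : ∀ i (f g : Q i ⟶ Q i), f + g = 𝟙 _ → IsIso f ∨ IsIso g) {M : C}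
    (hM : IsFiniteDirectSum Q M) :
    ∀ {X Y : C}, (X ⊞ Y ≅ M) → IsFiniteDirectSum Q X ∧ IsFiniteDirectSum Q Y := by
  induction hM with
  | zero h =>
    intro X Y e
    have h' := h.of_iso e
    rw [biprod_isZero_iff] at h'
    exact ⟨.zero h'.1, .zero h'.2⟩
  | cons i e' _ ih =>
    rename_i M N _
    intro X Y e₀
    obtain ⟨e⟩ : Nonempty (X ⊞ Y ≅ Q i ⊞ N) := ⟨e₀ ≪≫ e'⟩
    have hsum : (biprod.inl ≫ e.inv ≫ biprod.fst) ≫ biprod.inl ≫ e.hom ≫ biprod.fst +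
        (biprod.inl ≫ e.inv ≫ biprod.snd) ≫ biprod.inr ≫ e.hom ≫ biprod.fst = 𝟙 (Q i) := by
      have := biprod.total (X := X) (Y := Y)
      calc _ = biprod.inl ≫ e.inv ≫ (biprod.fst ≫ biprod.inl + biprod.snd ≫ biprod.inr) ≫
            e.hom ≫ biprod.fst := by
            simp only [Preadditive.add_comp, Preadditive.comp_add, Category.assoc]
        _ = _ := by rw [this]; simp
    -- One of the two components of `𝟙 (Q i)`, through `X` or through `Y`, is invertible.
    rcases hQ i _ _ hsum with h | h
    · obtain ⟨X', ⟨f⟩, ⟨g⟩⟩ := exists_biprod_iso_of_isIso e h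
      obtain ⟨h₁, h₂⟩ := ih g
      exact ⟨.cons i f h₁, h₂⟩
    · obtain ⟨Y', ⟨f⟩, ⟨g⟩⟩ := exists_biprod_iso_of_isIso (biprod.braiding Y X ≪≫ e)
        (by
          have h₁ : biprod.inl ≫ (biprod.braiding Y X).hom = biprod.inr := by ext <;> simp
          have h₂ : (biprod.braiding Y X).inv ≫ biprod.fst = biprod.snd := by simp
          simpa only [Iso.trans_inv, Iso.trans_hom, Category.assoc, reassoc_of% h₁, h₂] using h)
      obtain ⟨h₁, h₂⟩ := ih g
      exact ⟨h₂, .cons i f h₁⟩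

/-- Morphisms between distinct summands being zero, the endomorphism algebra of a direct sum is the
product of the endomorphism algebras of the summands. -/
theorem nonempty_end_biproduct_algEquiv [HasFiniteBiproducts C] {k : Type*} [CommRing k]
    [Linear k C] {ι : Type} [Finite ι] (Q : ι → C) (hQ : ∀ i j, i ≠ j → ∀ f : Q i ⟶ Q j, f = 0) :
    Nonempty (End (⨁ Q) ≃ₐ[k] ((i : ι) → End (Q i))) := by
  let φ : ((i : ι) → End (Q i)) →ₐ[k] End (⨁ Q) := AlgHom.ofLinearMap
    { toFun := fun g => (biproduct.map fun i => (g i : Q i ⟶ Q i) : ⨁ Q ⟶ ⨁ Q)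
      map_add' := fun f g => by
        refine biproduct.hom_ext _ _ fun i => ?_
        change biproduct.map _ ≫ _ = (biproduct.map _ + biproduct.map _) ≫ _
        simp only [biproduct.map_π, Preadditive.add_comp]
        exact Preadditive.comp_add _ _ _ _ _ _
      map_smul' := fun c g => by
        refine biproduct.hom_ext _ _ fun i => ?_
        change biproduct.map _ ≫ _ = (c • biproduct.map _) ≫ _
        simp only [biproduct.map_π, Linear.smul_comp]
        exact Linear.comp_smul _ _ _ _ _ _ }
    (by
      refine biproduct.hom_ext _ _ fun i => ?_
      change biproduct.map _ ≫ _ = 𝟙 _ ≫ _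
      simp only [biproduct.map_π]
      change _ ≫ 𝟙 _ = _
      simp)
    (fun f g => by
      refine biproduct.hom_ext _ _ fun i => ?_
      change biproduct.map _ ≫ _ = (biproduct.map _ ≫ biproduct.map _) ≫ _
      simp only [Category.assoc, biproduct.map_π, biproduct.map_π_assoc]
      rfl)
  refine ⟨(AlgEquiv.ofBijective φ ⟨fun f g h => ?_, fun f => ?_⟩).symm⟩
  · funext i
    have h' : biproduct.ι Q i ≫ biproduct.map f ≫ biproduct.π Q i =
        biproduct.ι Q i ≫ biproduct.map g ≫ biproduct.π Q i :=
      congrArg (fun x : ⨁ Q ⟶ ⨁ Q => biproduct.ι Q i ≫ x ≫ biproduct.π Q i) h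
    simpa using h'
  · refine ⟨fun i => biproduct.ι Q i ≫ (f : ⨁ Q ⟶ ⨁ Q) ≫ biproduct.π Q i, ?_⟩
    refine biproduct.hom_ext' _ _ fun i => biproduct.hom_ext _ _ fun j => ?_
    change (biproduct.ι Q i ≫ biproduct.map _) ≫ _ = _
    by_cases h : i = j
    · subst h
      simp
    · rw [hQ i j h ((biproduct.ι Q i ≫ _) ≫ _), hQ i j h ((biproduct.ι Q i ≫ f) ≫ _)]

/-! ### Consequences of the vanishing of `Ext¹` -/

variable [HasExt.{w} C]

theorem exists_comp_eq_of_ext_eq_zero {S : ShortComplex C} (hS : S.ShortExact) {P : C}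
    (h : ∀ e : Abelian.Ext P S.X₁ 1, e = 0) (f : P ⟶ S.X₃) : ∃ g : P ⟶ S.X₂, g ≫ S.g = f := by
  obtain ⟨x, hx⟩ := Abelian.Ext.covariant_sequence_exact₃ P hS (Abelian.Ext.mk₀ f) (zero_add 1)
    (h _)
  obtain ⟨g, rfl⟩ := Abelian.Ext.addEquiv₀.symm.surjective x
  refine ⟨g, Abelian.Ext.addEquiv₀.symm.injective ?_⟩
  exact (Abelian.Ext.mk₀_comp_mk₀ g S.g).symm.trans hx

theorem nonempty_iso_biprod_of_ext_eq_zero {S : ShortComplex C} (hS : S.ShortExact)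
    (h : ∀ e : Abelian.Ext S.X₃ S.X₁ 1, e = 0) : Nonempty (S.X₂ ≅ S.X₁ ⊞ S.X₃) := by
  obtain ⟨s, hs⟩ := exists_comp_eq_of_ext_eq_zero hS h (𝟙 _)
  exact ⟨(ShortComplex.Splitting.ofExactOfSection S hS.exact s hs hS.mono_f).isoBinaryBiproduct⟩

theorem CategoryTheory.Retract.ext_eq_zero {P R X : C} (r : Retract P R) {n : ℕ}
    (h : ∀ e : Abelian.Ext R X n, e = 0) (e : Abelian.Ext P X n) : e = 0 := by
  rw [← Abelian.Ext.mk₀_id_comp e, ← r.retract, ← Abelian.Ext.mk₀_comp_mk₀_assoc,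
    h ((Abelian.Ext.mk₀ r.r).comp e (zero_add n)), Abelian.Ext.comp_zero]

end DirectSums

/-! ### Filtrations as iterated extensions -/

section Filtrations

variable {A : Type u} [Ring A] {ι : Type v} {Θ : ι → ModuleCat.{u} A}

/-- `IsIteratedExtension Θ M m` says that `M` is obtained from a zero module by iterated extensions
with quotients in the family `Θ`, the member `Θ j` being used `m j` times. This is the inductive
form of having a filtration by `Θ` with multiplicities `m`. -/
inductive IsIteratedExtension [DecidableEq ι] (Θ : ι → ModuleCat.{u} A) :
    ModuleCat.{u} A → (ι → ℕ) → Prop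
  | zero {M : ModuleCat.{u} A} (h : IsZero M) : IsIteratedExtension Θ M 0
  | step {S : ShortComplex (ModuleCat.{u} A)} {m : ι → ℕ} {j : ι} (hS : S.ShortExact)
      (e : S.X₃ ≅ Θ j) (h : IsIteratedExtension Θ S.X₁ m) :
      IsIteratedExtension Θ S.X₂ (m + Pi.single j 1)

theorem IsIteratedExtension.of_iso [DecidableEq ι] {M N : ModuleCat.{u} A} {m : ι → ℕ}
    (h : IsIteratedExtension Θ M m) (e : M ≅ N) : IsIteratedExtension Θ N m := by
  cases h with
  | zero h => exact .zero (h.of_iso e.symm)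
  | step hS e' h =>
    rename_i S m j
    let T : ShortComplex (ModuleCat.{u} A) := ShortComplex.mk (S.f ≫ e.hom) (e.inv ≫ S.g) (by simp)
    have hT : T.ShortExact :=
      ShortComplex.shortExact_of_iso
        (ShortComplex.isoMk (S₁ := S) (S₂ := T) (Iso.refl _) e (Iso.refl _) (by simp [T])
          (by simp [T])) hS
    exact IsIteratedExtension.step (S := T) hT e' h

theorem ModuleFiltration.isIteratedExtension [DecidableEq ι] {M : ModuleCat.{u} A}
    (F : ModuleFiltration Θ M) :
    IsIteratedExtension Θ M F.mult := by
  -- The multiplicities of the `l`-th submodule count the steps below `l`.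
  have key : ∀ l : Fin (F.length + 1), IsIteratedExtension Θ (ModuleCat.of A (F.sub l))
      fun j => Nat.card {a : Fin F.length // a.castSucc < l ∧ F.label a = j} := by
    intro l
    induction l using Fin.induction with
    | zero =>
      have h₀ : IsZero (ModuleCat.of A (F.sub 0)) := by
        rw [ModuleCat.isZero_iff_subsingleton]
        exact (Submodule.subsingleton_iff_eq_bot).2 F.sub_zero
      convert IsIteratedExtension.zero (Θ := Θ) h₀ using 1
      funext j
      simp
    | succ l ih =>
      have hle : F.sub l.castSucc ≤ F.sub l.succ := F.monotone_sub l.castSucc_le_succ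
      let S : ShortComplex (ModuleCat.{u} A) := ShortComplex.mk
        (ModuleCat.ofHom (Submodule.inclusion hle))
        (ModuleCat.ofHom ((F.sub l.castSucc).submoduleOf (F.sub l.succ)).mkQ) (by
          ext x
          exact (Submodule.Quotient.mk_eq_zero _).2 x.2)
      have hS : S.ShortExact := by
        refine ModuleCat.shortComplex_shortExact S (fun x => ?_) ?_ ?_
        · simp only [S, ModuleCat.hom_ofHom, Submodule.mkQ_apply, Submodule.Quotient.mk_eq_zero]
          exact ⟨fun h => ⟨⟨x, h⟩, rfl⟩, by rintro ⟨y, rfl⟩; exact y.2⟩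
        · exact Submodule.inclusion_injective hle
        · exact Submodule.mkQ_surjective _
      convert IsIteratedExtension.step (Θ := Θ) hS (F.quotient_iso l).some.toModuleIso ih using 1
      funext j
      simp only [Pi.add_apply, Nat.card_eq_fintype_card, Fintype.card_subtype]
      rw [Pi.single_apply]
      have hlt : ∀ a : Fin F.length, a.castSucc < l.succ ↔ a.castSucc < l.castSucc ∨ a = l := by
        intro a
        simp only [Fin.lt_def, Fin.ext_iff, Fin.val_castSucc, Fin.val_succ]
        omega
      split_ifs with h
      · subst h
        rw [← Finset.card_insert_of_notMem (a := l) (by simp)]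
        refine congrArg Finset.card ?_
        ext a
        simp only [hlt, Finset.mem_filter, Finset.mem_univ, true_and, Finset.mem_insert]
        grind
      · refine (congrArg Finset.card ?_).trans (add_zero _).symm
        ext a
        simp only [hlt, Finset.mem_filter, Finset.mem_univ, true_and]
        grind
  have hlast := key (Fin.last _)
  have e : ModuleCat.of A (F.sub (Fin.last _)) ≅ M :=
    (LinearEquiv.ofTop _ F.sub_last).toModuleIso
  convert hlast.of_iso e using 1
  funext j
  exact Nat.card_congr (Equiv.subtypeEquivRight fun a => by simp [Fin.castSucc_lt_last])

/-- The quotient of two submodules is unchanged under an injective linear map. -/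
noncomputable def quotientMapEquivOfInjective {M N : Type*} [AddCommGroup M] [Module A M]
    [AddCommGroup N] [Module A N] (f : M →ₗ[A] N) (hf : Function.Injective f)
    (p q : Submodule A M) :
    (↥(p.map f) ⧸ (q.map f).submoduleOf (p.map f)) ≃ₗ[A] (↥p ⧸ q.submoduleOf p) :=
  (Submodule.Quotient.equiv _ _ (Submodule.equivMapOfInjective f hf p) (by
    ext ⟨y, hy⟩
    obtain ⟨x, hx, rfl⟩ := hy
    constructor
    · rintro ⟨z, hz, hzx⟩
      exact ⟨z, hz, congrArg Subtype.val hzx⟩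
    · rintro ⟨z, hz, hzx⟩
      obtain rfl := hf hzx
      exact ⟨⟨z, hx⟩, hz, rfl⟩)).symm

/-- A filtration of the kernel of a map onto a member of the family is extended by one top step. -/
theorem filteredBy_of_shortExact {S : ShortComplex (ModuleCat.{u} A)} (hS : S.ShortExact) {j : ι}
    (e : S.X₃ ≅ Θ j) (h : filteredBy Θ S.X₁) : filteredBy Θ S.X₂ := by
  obtain ⟨F⟩ := h
  have hf : Function.Injective S.f.hom := hS.moduleCat_injective_f
  have hex : Function.Exact S.f.hom S.g.hom :=
    (ShortComplex.ShortExact.moduleCat_exact_iff_function_exact S).1 hS.exact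
  refine ⟨{
    length := F.length + 1
    sub := Fin.snoc (α := fun _ => Submodule A S.X₂) (fun l => (F.sub l).map S.f.hom) ⊤
    label := Fin.snoc (α := fun _ => ι) F.label j
    sub_zero := ?_
    sub_last := by simp
    monotone_sub := ?_
    quotient_iso := fun l => ?_ }⟩
  · refine Fin.monotone_iff_le_succ.2 fun l => ?_
    refine Fin.lastCases ?_ (fun l => ?_) l
    · simp
    · rw [Fin.succ_castSucc, Fin.snoc_castSucc, Fin.snoc_castSucc]
      exact Submodule.map_mono (F.monotone_sub l.castSucc_le_succ)
  · rw [← Fin.castSucc_zero, Fin.snoc_castSucc, F.sub_zero, Submodule.map_bot]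
  · refine Fin.lastCases ?_ (fun l => ?_) l
    · have h₁ : (Fin.snoc (α := fun _ => Submodule A S.X₂) (fun l => (F.sub l).map S.f.hom) ⊤
          (Fin.last F.length).succ) = ⊤ := by simp
      have h₂ : (Fin.snoc (α := fun _ => Submodule A S.X₂) (fun l => (F.sub l).map S.f.hom) ⊤
          (Fin.last F.length).castSucc) = LinearMap.ker S.g.hom := by
        rw [Fin.snoc_castSucc, F.sub_last, Submodule.map_top]
        exact hex.linearMap_ker_eq.symm
      rw [h₁, h₂, Fin.snoc_last]
      refine ⟨(Submodule.Quotient.equiv _ (LinearMap.ker S.g.hom) Submodule.topEquiv ?_).trans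
        ((S.g.hom.quotKerEquivOfSurjective hS.moduleCat_surjective_g).trans e.toLinearEquiv)⟩
      ext x
      constructor
      · rintro ⟨y, hy, rfl⟩
        exact hy
      · exact fun hx => ⟨⟨x, trivial⟩, hx, rfl⟩
    · rw [Fin.succ_castSucc, Fin.snoc_castSucc, Fin.snoc_castSucc, Fin.snoc_castSucc]
      exact ⟨(quotientMapEquivOfInjective S.f.hom hf _ _).trans (F.quotient_iso l).some⟩

theorem filteredBy_of_isZero {M : ModuleCat.{u} A} (h : IsZero M) : filteredBy Θ M := by
  have : Subsingleton M := ModuleCat.isZero_iff_subsingleton.1 h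
  exact ⟨{
    length := 0
    sub := fun _ => ⊥
    monotone_sub := monotone_const
    sub_zero := rfl
    sub_last := Subsingleton.elim _ _
    label := Fin.elim0
    quotient_iso := fun l => l.elim0 }⟩

theorem IsIteratedExtension.filteredBy [DecidableEq ι] {M : ModuleCat.{u} A} {m : ι → ℕ}
    (h : IsIteratedExtension Θ M m) : filteredBy Θ M := by
  induction h with
  | zero h => exact filteredBy_of_isZero h
  | step hS e _ ih => exact filteredBy_of_shortExact hS e ih

theorem IsFiniteDirectSum.filteredBy {M : ModuleCat.{u} A} (h : IsFiniteDirectSum Θ M) :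
    filteredBy Θ M := by
  induction h with
  | zero h => exact filteredBy_of_isZero h
  | cons i e _ ih =>
    rename_i M N _
    let T : ShortComplex (ModuleCat.{u} A) :=
      ShortComplex.mk (biprod.inr ≫ e.inv) (e.hom ≫ biprod.fst) (by simp)
    have hT : T.ShortExact := ShortComplex.Splitting.shortExact
      { r := e.hom ≫ biprod.snd
        s := biprod.inl ≫ e.inv
        f_r := by simp [T]
        s_g := by simp [T]
        id := by
          have := biprod.total (X := Θ i) (Y := N)
          calc _ = e.hom ≫ (biprod.fst ≫ biprod.inl + biprod.snd ≫ biprod.inr) ≫ e.inv := by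
                simp only [T, Preadditive.add_comp, Preadditive.comp_add, Category.assoc, add_comm]
            _ = _ := by rw [this]; simp [T] }
    exact filteredBy_of_shortExact (S := T) hT (Iso.refl _) ih

theorem IsIteratedExtension.ext_eq_zero [DecidableEq ι] {Z : ModuleCat.{u} A}
    (hZ : ∀ (j : ι) (e : Abelian.Ext Z (Θ j) 1), e = 0) {M : ModuleCat.{u} A}
    {m : ι → ℕ} (h : IsIteratedExtension Θ M m) (e : Abelian.Ext Z M 1) : e = 0 := by
  induction h with
  | zero h =>
    rw [← Abelian.Ext.comp_mk₀_id e, h.eq_of_src (𝟙 _) 0, Abelian.Ext.mk₀_zero,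
      Abelian.Ext.comp_zero]
  | step hS e' _ ih =>
    rename_i S m j _
    have h₃ : e.comp (Abelian.Ext.mk₀ S.g) (add_zero 1) = 0 := by
      have h₄ := hZ j ((e.comp (Abelian.Ext.mk₀ S.g) (add_zero 1)).comp
        (Abelian.Ext.mk₀ e'.hom) (add_zero 1))
      have h₅ := congrArg
        (fun x : Abelian.Ext Z (Θ j) 1 => x.comp (Abelian.Ext.mk₀ e'.inv) (add_zero 1)) h₄
      simpa using h₅
    obtain ⟨x, rfl⟩ := Abelian.Ext.covariant_sequence_exact₂ Z hS e h₃
    rw [ih x, Abelian.Ext.zero_comp]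

/-- If all members of `Θ` are orthogonal for `Ext¹`, then every filtration splits. -/
theorem IsIteratedExtension.isFiniteDirectSum [DecidableEq ι]
    (hΘ : ∀ (i j : ι) (e : Abelian.Ext (Θ i) (Θ j) 1), e = 0) {M : ModuleCat.{u} A}
    {m : ι → ℕ} (h : IsIteratedExtension Θ M m) : IsFiniteDirectSum Θ M := by
  induction h with
  | zero h => exact .zero h
  | step hS e' h ih =>
    rename_i S m j
    obtain ⟨f⟩ := nonempty_iso_biprod_of_ext_eq_zero hS
      ((Retract.ofIso e').ext_eq_zero fun e => h.ext_eq_zero (hΘ j) e)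
    exact .cons j (f ≪≫ biprod.braiding _ _ ≪≫ biprod.mapIso e' (Iso.refl _)) ih

end Filtrations

/-! ### Local endomorphism rings and dimensions of Hom spaces -/

section Modules

variable {A : Type u} [Ring A]

/-- Fitting's lemma: an indecomposable module of finite length has a local endomorphism ring. -/
theorem isIso_or_isIso_of_indecomposable {Q : ModuleCat.{u} A} [IsNoetherian A Q]
    [IsArtinian A Q] (hQ : Indecomposable Q) {f g : Q ⟶ Q} (hfg : f + g = 𝟙 Q) :
    IsIso f ∨ IsIso g := by
  have hfg' : g.hom = 1 - f.hom := by
    rw [eq_sub_iff_add_eq', ← ModuleCat.hom_add, hfg]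
    rfl
  obtain ⟨n, hn, hn₁⟩ := (f.hom.eventually_isCompl_ker_pow_range_pow.and
    (Filter.eventually_ge_atTop 1)).exists
  have e : Q ≅ ModuleCat.of A (LinearMap.ker (f.hom ^ n)) ⊞
      ModuleCat.of A (LinearMap.range (f.hom ^ n)) :=
    (Submodule.prodEquivOfIsCompl _ _ hn).symm.toModuleIso ≪≫
      (ModuleCat.biprodIsoProd (.of A _) (.of A _)).symm
  rcases hQ.2 _ _ e with h | h
  -- By indecomposability the Fitting decomposition is trivial: `f` is invertible or nilpotent.
  · left
    rw [ModuleCat.isZero_iff_subsingleton] at h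
    have hbot : LinearMap.ker (f.hom ^ n) = ⊥ := Submodule.subsingleton_iff_eq_bot.1 h
    have htop : LinearMap.range (f.hom ^ n) = ⊤ :=
      eq_top_of_bot_isCompl (hbot ▸ hn)
    have hu : IsUnit (f.hom ^ n) :=
      (Module.End.isUnit_iff _).2 ⟨LinearMap.ker_eq_bot.1 hbot, LinearMap.range_eq_top.1 htop⟩
    have hf := (Module.End.isUnit_iff _).1 ((isUnit_pow_iff (by omega)).1 hu)
    exact (ConcreteCategory.isIso_iff_bijective f).2 hf
  · right
    rw [ModuleCat.isZero_iff_subsingleton] at h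
    have hzero : f.hom ^ n = 0 := LinearMap.range_eq_bot.1 (Submodule.subsingleton_iff_eq_bot.1 h)
    have hg : IsUnit g.hom := hfg' ▸ IsNilpotent.isUnit_one_sub ⟨n, hzero⟩
    exact (ConcreteCategory.isIso_iff_bijective g).2 ((Module.End.isUnit_iff _).1 hg)

variable {k : Type w} [Field k] [Algebra k A]

theorem finite_hom [Module.Finite k A] (M N : ModuleCat.{u} A) [Module.Finite A M]
    [Module.Finite A N] : Module.Finite k (M ⟶ N) := by
  have := Module.Finite.trans (R := k) A M
  have := Module.Finite.trans (R := k) A N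
  let φ : (M ⟶ N) →ₗ[k] (M →ₗ[k] N) :=
    { toFun := fun f => f.hom.restrictScalars k
      map_add' := fun f g => rfl
      map_smul' := fun c f => rfl }
  exact Module.Finite.of_injective φ fun f g h => by
    ext x
    exact LinearMap.congr_fun h x

/-- The functor `Hom(P, -)` is exact on sequences whose left term is `Ext¹`-orthogonal to `P`. -/
theorem finrank_hom_of_shortExact {S : ShortComplex (ModuleCat.{u} A)} (hS : S.ShortExact)
    {P : ModuleCat.{u} A} (hP : ∀ e : Abelian.Ext P S.X₁ 1, e = 0)
    [Module.Finite k (P ⟶ S.X₁)] [Module.Finite k (P ⟶ S.X₃)] :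
    Module.Finite k (P ⟶ S.X₂) ∧ Module.finrank k (P ⟶ S.X₂) =
      Module.finrank k (P ⟶ S.X₁) + Module.finrank k (P ⟶ S.X₃) := by
  let φ : (P ⟶ S.X₁) →ₗ[k] (P ⟶ S.X₂) := Linear.rightComp k P S.f
  let ψ : (P ⟶ S.X₂) →ₗ[k] (P ⟶ S.X₃) := Linear.rightComp k P S.g
  have hφ : Function.Injective φ := fun a b h => by
    have := hS.mono_f
    exact (cancel_mono S.f).1 h
  have hψ : Function.Surjective ψ := exists_comp_eq_of_ext_eq_zero hS hP
  have hex : Function.Exact φ ψ := fun a => by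
    have := hS.mono_f
    refine ⟨fun h => ⟨hS.exact.lift a h, hS.exact.lift_f a h⟩, ?_⟩
    rintro ⟨b, rfl⟩
    simp [φ, ψ]
  have hfin := Module.Finite.of_exact hex hψ
  refine ⟨hfin, ?_⟩
  rw [← LinearMap.finrank_range_add_finrank_ker ψ, hex.linearMap_ker_eq,
    LinearMap.finrank_range_of_inj hφ, LinearMap.range_eq_top.2 hψ, finrank_top, add_comm]

end Modules

namespace ExtProjectiveStratifyingSystem

variable {A : Type u} [Ring A] {t : ℕ} (S : ExtProjectiveStratifyingSystem A t)

theorem ext_Q_eq_zero (i : Fin t) {X : ModuleCat.{u} A} (hX : filteredBy S.Θ X)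
    (e : Abelian.Ext (S.Q i) X 1) : e = 0 :=
  Retract.ext_eq_zero (R := ⨁ S.Q)
    { i := biproduct.ι S.Q i, r := biproduct.π S.Q i } (S.ext_eq_zero X hX) e

variable {k : Type w} [Field k] [Algebra k A]

theorem finrank_hom_pos [Module.Finite k A] (i : Fin t) : 0 < Module.finrank k (S.Q i ⟶ S.Θ i) := by
  have := S.finite_Q i
  have := S.finite_Θ i
  have := finite_hom (k := k) (S.Q i) (S.Θ i)
  refine Module.finrank_pos_iff_exists_ne_zero.2 ⟨S.β i, fun h => S.nonzero_Θ i ?_⟩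
  have : Epi (S.β i) := (S.exact i).epi_g
  exact IsZero.of_epi_eq_zero _ h

theorem finrank_hom_of_ne (hdiag : (S.cartanMatrix k).IsDiag) {i j : Fin t} (hij : i ≠ j) :
    Module.finrank k (S.Q i ⟶ S.Θ j) = 0 := by
  have := hdiag hij
  simpa [cartanMatrix] using this

theorem hom_eq_zero_of_ne [Module.Finite k A] (hdiag : (S.cartanMatrix k).IsDiag) {i j : Fin t}
    (hij : i ≠ j) (f : S.Q i ⟶ S.Θ j) : f = 0 := by
  have := S.finite_Q i
  have := S.finite_Θ j
  have := finite_hom (k := k) (S.Q i) (S.Θ j)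
  have := Module.finrank_zero_iff.1 (S.finrank_hom_of_ne hdiag hij)
  exact Subsingleton.elim _ _

/-- As `Hom(Q i, -)` is exact on filtered modules, a diagonal Cartan matrix makes the dimension of
`Hom(Q i, M)` count the occurrences of `Θ i` alone. -/
theorem finrank_hom_eq_mul [Module.Finite k A] (hdiag : (S.cartanMatrix k).IsDiag) (i : Fin t)
    {M : ModuleCat.{u} A} {m : Fin t → ℕ} (h : IsIteratedExtension S.Θ M m) :
    Module.Finite k (S.Q i ⟶ M) ∧
      Module.finrank k (S.Q i ⟶ M) = m i * Module.finrank k (S.Q i ⟶ S.Θ i) := by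
  induction h with
  | zero h =>
    have : Subsingleton (S.Q i ⟶ _) := ⟨fun f g => h.eq_of_tgt f g⟩
    exact ⟨inferInstance, by simp [Module.finrank_zero_of_subsingleton]⟩
  | step hT e h ih =>
    rename_i T m j
    have := ih.1
    have := S.finite_Q i
    have := S.finite_Θ j
    have := finite_hom (k := k) (S.Q i) (S.Θ j)
    let f : (S.Q i ⟶ T.X₃) ≃ₗ[k] (S.Q i ⟶ S.Θ j) := Linear.homCongr k (Iso.refl _) e
    have := Module.Finite.equiv f.symm
    obtain ⟨h₁, h₂⟩ := finrank_hom_of_shortExact (k := k) hT (S.ext_Q_eq_zero i h.filteredBy)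
    refine ⟨h₁, ?_⟩
    rw [h₂, ih.2, f.finrank_eq, Pi.add_apply, add_mul, Pi.single_apply]
    split_ifs with hij
    · rw [hij, one_mul]
    · rw [S.finrank_hom_of_ne hdiag hij, zero_mul]

end ExtProjectiveStratifyingSystem

/-! ### The additive closure -/

section AddClosure

variable {A : Type u} [Ring A]

theorem addClosure_of_retract {Q X : ModuleCat.{u} A} {n : ℕ}
    (r : Retract X (⨁ fun _ : Fin n => Q)) : addClosure Q X := by
  obtain ⟨Y, e, -⟩ := r.exists_iso_biprod
  exact ⟨n, Y, ⟨e.symm⟩⟩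

theorem IsFiniteDirectSum.addClosure {t : ℕ} {Q : Fin t → ModuleCat.{u} A} {M : ModuleCat.{u} A}
    (hM : IsFiniteDirectSum Q M) : addClosure (⨁ Q) M := by
  suffices h : ∃ n : ℕ, Nonempty (Retract M (⨁ fun _ : Fin n => ⨁ Q)) by
    obtain ⟨n, ⟨r⟩⟩ := h
    exact addClosure_of_retract r
  induction hM with
  | zero h => exact ⟨0, ⟨{ i := 0, r := 0, retract := h.eq_of_src _ _ }⟩⟩
  | cons i e _ ih =>
    rename_i M N _
    obtain ⟨n, ⟨r⟩⟩ := ih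
    let f := biproductFinSuccIso (fun _ : Fin (n + 1) => ⨁ Q)
    exact ⟨n + 1, ⟨
      { i := e.hom ≫ biprod.map (biproduct.ι Q i) r.i ≫ f.inv
        r := f.hom ≫ biprod.map (biproduct.π Q i) r.r ≫ e.inv
        retract := by
          have : biprod.map (biproduct.ι Q i) r.i ≫ biprod.map (biproduct.π Q i) r.r =
              𝟙 (Q i ⊞ N) := by
            apply biprod.hom_ext' <;> simp
          simp [reassoc_of% this] }⟩⟩

theorem addClosure.isFiniteDirectSum {t : ℕ} {Q : Fin t → ModuleCat.{u} A}
    (hQ : ∀ i (f g : Q i ⟶ Q i), f + g = 𝟙 _ → IsIso f ∨ IsIso g) {M : ModuleCat.{u} A}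
    (hM : addClosure (⨁ Q) M) : IsFiniteDirectSum Q M := by
  obtain ⟨n, Y, ⟨e⟩⟩ := hM
  exact (IsFiniteDirectSum.of_biprod_iso hQ (IsFiniteDirectSum.biproduct _ fun _ =>
    IsFiniteDirectSum.biproduct _ fun i => .single i (Iso.refl _)) e).1

end AddClosure

/-! ### Systems with a diagonal Cartan matrix -/

/-- A filtration by a subfamily, regarded as a filtration by the whole family. -/
def ModuleFiltration.relabel {A : Type u} [Ring A] {ι κ : Type*} {Θ : ι → ModuleCat.{u} A}
    (p : κ → ι) {M : ModuleCat.{u} A} (F : ModuleFiltration (fun a => Θ (p a)) M) :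
    ModuleFiltration Θ M where
  length := F.length
  sub := F.sub
  monotone_sub := F.monotone_sub
  sub_zero := F.sub_zero
  sub_last := F.sub_last
  label l := p (F.label l)
  quotient_iso := F.quotient_iso

theorem ModuleFiltration.isZero_of_length_eq_zero {A : Type u} [Ring A] {ι : Type*}
    {Θ : ι → ModuleCat.{u} A} {M : ModuleCat.{u} A} (F : ModuleFiltration Θ M)
    (h : F.length = 0) : IsZero M := by
  have hlast : Fin.last F.length = 0 := Fin.ext h
  have : (⊥ : Submodule A M) = ⊤ := by rw [← F.sub_zero, ← F.sub_last, hlast]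
  rw [ModuleCat.isZero_iff_subsingleton]
  exact (Submodule.subsingleton_iff A).1 (subsingleton_of_bot_eq_top this)

namespace ExtProjectiveStratifyingSystem

variable {k : Type w} [Field k] {A : Type u} [Ring A] [Algebra k A] {t : ℕ}
  (S : ExtProjectiveStratifyingSystem A t)

theorem mult_eq_filtMult [Module.Finite k A] (hdiag : (S.cartanMatrix k).IsDiag)
    {M : ModuleCat.{u} A} (F : ModuleFiltration S.Θ M) (j : Fin t) :
    F.mult j = filtMult S.Θ M j := by
  have h : Nonempty (ModuleFiltration S.Θ M) := ⟨F⟩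
  rw [filtMult, dif_pos h]
  have h₁ := (S.finrank_hom_eq_mul hdiag j F.isIteratedExtension).2
  have h₂ := (S.finrank_hom_eq_mul hdiag j h.some.isIteratedExtension).2
  exact Nat.eq_of_mul_eq_mul_right (S.finrank_hom_pos (k := k) j) (h₁.symm.trans h₂)

theorem isZero_U_of_filtMult_eq_zero [Module.Finite k A] (hdiag : (S.cartanMatrix k).IsDiag)
    {i : Fin t} (h : ∀ j, i < j → filtMult S.Θ (S.U i) j = 0) : IsZero (S.U i) := by
  obtain ⟨F⟩ := S.filtered_U i
  refine F.isZero_of_length_eq_zero ?_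
  by_contra hF
  let l : Fin F.length := ⟨0, Nat.pos_of_ne_zero hF⟩
  have h₀ := h (F.label l) (F.label l).2
  let G : ModuleFiltration S.Θ (S.U i) := F.relabel (Θ := S.Θ) Subtype.val
  rw [← S.mult_eq_filtMult hdiag G] at h₀
  have : Finite {a // G.label a = F.label l} := Subtype.finite
  exact (Finite.card_eq_zero_iff.1 h₀).false ⟨l, rfl⟩

theorem filtMult_eq_zero_of_isZero [Module.Finite k A] (hdiag : (S.cartanMatrix k).IsDiag)
    {M : ModuleCat.{u} A} (hM : IsZero M) (j : Fin t) : filtMult S.Θ M j = 0 := by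
  obtain ⟨F⟩ := filteredBy_of_isZero (Θ := S.Θ) hM
  rw [← S.mult_eq_filtMult hdiag F]
  have : Subsingleton (S.Q j ⟶ M) := ⟨fun f g => hM.eq_of_tgt f g⟩
  have h := (S.finrank_hom_eq_mul hdiag j F.isIteratedExtension).2
  rw [Module.finrank_zero_of_subsingleton, eq_comm, mul_eq_zero] at h
  exact h.resolve_right (S.finrank_hom_pos j).ne'

theorem nonempty_Q_iso_Θ {i : Fin t} (h : IsZero (S.U i)) : Nonempty (S.Q i ≅ S.Θ i) := by
  have := (S.exact i).isIso_g_iff.2 h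
  exact ⟨asIso (S.β i)⟩

theorem filteredBy_Θ (i : Fin t) : filteredBy S.Θ (S.Θ i) :=
  (IsFiniteDirectSum.single i (Iso.refl _)).filteredBy

theorem ext_Θ_eq_zero (h : ∀ i, Nonempty (S.Q i ≅ S.Θ i)) (i j : Fin t)
    (e : Abelian.Ext (S.Θ i) (S.Θ j) 1) : e = 0 :=
  (Retract.ofIso (h i).some.symm).ext_eq_zero (S.ext_Q_eq_zero i (S.filteredBy_Θ j)) e

theorem isZero_U_of_ext_eq_zero
    (h : ∀ (i j : Fin t) (e : Abelian.Ext (S.Θ i) (S.Θ j) 1), e = 0) (i : Fin t) :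
    IsZero (S.U i) := by
  obtain ⟨F⟩ := S.filtered_U i
  let G : ModuleFiltration S.Θ (S.U i) := F.relabel (Θ := S.Θ) Subtype.val
  have hU : ∀ e : Abelian.Ext (S.Θ i) (S.U i) 1, e = 0 :=
    G.isIteratedExtension.ext_eq_zero fun j => h i j
  obtain ⟨e⟩ := nonempty_iso_biprod_of_ext_eq_zero (S.exact i) hU
  exact ((S.indecomposable_Q i).2 _ _ e).resolve_right (S.nonzero_Θ i)

theorem filteredBy_eq_addClosure [Module.Finite k A] (h : ∀ i, Nonempty (S.Q i ≅ S.Θ i)) :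
    filteredBy S.Θ = addClosure (⨁ S.Q) := by
  have := IsArtinianRing.of_finite k A
  have := IsNoetherianRing.of_finite k A
  funext M
  refine propext ⟨fun ⟨F⟩ => ?_, fun hM => ?_⟩
  · exact ((F.isIteratedExtension.isFiniteDirectSum (S.ext_Θ_eq_zero h)).map
      fun i => ⟨i, ⟨(h i).some.symm⟩⟩).addClosure
  · refine ((addClosure.isFiniteDirectSum (fun i f g hfg => ?_) hM).map
      fun i => ⟨i, h i⟩).filteredBy
    have := S.finite_Q i
    exact isIso_or_isIso_of_indecomposable (S.indecomposable_Q i) hfg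

end ExtProjectiveStratifyingSystem

theorem corollary3p6 {k : Type w} [Field k] {A : Type u} [Ring A] [Algebra k A]
    [Module.Finite k A] {t : ℕ} (S : ExtProjectiveStratifyingSystem A t)
    (hdiag : (S.cartanMatrix k).IsDiag) :
    -- the multiplicities are independent of the filtration
    (∀ (M : ModuleCat.{u} A) (F : ModuleFiltration S.Θ M) (j : Fin t),
      F.mult j = filtMult S.Θ M j) ∧
    [ (∀ i j : Fin t, i < j → filtMult S.Θ (S.U i) j = 0),
      (∀ (i j : Fin t) (e : Abelian.Ext (S.Θ i) (S.Θ j) 1), e = 0),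
      (∀ i : Fin t, Nonempty (S.Q i ≅ S.Θ i)),
      (∀ i : Fin t, IsZero (S.U i)) ].TFAE ∧
    (((∀ i j : Fin t, i < j → filtMult S.Θ (S.U i) j = 0) ∨
      (∀ (i j : Fin t) (e : Abelian.Ext (S.Θ i) (S.Θ j) 1), e = 0) ∨
      (∀ i : Fin t, Nonempty (S.Q i ≅ S.Θ i)) ∨
      (∀ i : Fin t, IsZero (S.U i))) →
      filteredBy S.Θ = addClosure (⨁ S.Q) ∧
      Nonempty (End (⨁ S.Q) ≃ₐ[k] ((i : Fin t) → End (S.Q i)))) := by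
  have tfae : [ (∀ i j : Fin t, i < j → filtMult S.Θ (S.U i) j = 0),
      (∀ (i j : Fin t) (e : Abelian.Ext (S.Θ i) (S.Θ j) 1), e = 0),
      (∀ i : Fin t, Nonempty (S.Q i ≅ S.Θ i)),
      (∀ i : Fin t, IsZero (S.U i)) ].TFAE := by
    tfae_have 1 → 4 := fun h i => S.isZero_U_of_filtMult_eq_zero hdiag (h i)
    tfae_have 4 → 3 := fun h i => S.nonempty_Q_iso_Θ (h i)
    tfae_have 3 → 2 := S.ext_Θ_eq_zero
    tfae_have 2 → 4 := S.isZero_U_of_ext_eq_zero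
    tfae_have 4 → 1 := fun h i j _ => S.filtMult_eq_zero_of_isZero hdiag (h i) j
    tfae_finish
  refine ⟨fun M F j => S.mult_eq_filtMult hdiag F j, tfae, fun h => ?_⟩
  have hQ : ∀ i : Fin t, Nonempty (S.Q i ≅ S.Θ i) := by
    rcases h with h | h | h | h
    · exact (tfae.out 0 2).1 h
    · exact (tfae.out 1 2).1 h
    · exact h
    · exact (tfae.out 3 2).1 h
  refine ⟨S.filteredBy_eq_addClosure (k := k) hQ,
    nonempty_end_biproduct_algEquiv S.Q fun i j hij f => ?_⟩
  rw [← cancel_mono (hQ j).some.hom, zero_comp]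
  exact S.hom_eq_zero_of_ne hdiag hij _
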